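/- **Theorem (Consistency, case $s=1$).** Let $T>0$, let $a,b\in L^\infty(0,1)$ be non-negative and let $q\in L^\infty(0,1)$ be real. Write $\mathcal L_q=-\frac{d^2}{dx^2}+q$ for the Sturm–Liouville operator in $L^2(0,1)$ (complex-valued functions) with domain $\{f\in L^2: f''\in L^2,\ f(0)=f(1)=0\}$; powers $\mathcal L_q^{s}$ are defined by $\mathcal L_q^{s}\phi=\lambda^{s}\phi$ on the eigenfunctions $\mathcal L_q\phi=\lambda\phi$ (principal power if $\lambda<0$), and $W^1_{\mathcal L_q}=\{f\in L^2:\mathcal L_q^{1/2}f\in L^2\}$ carries the (semi)norm $\|\mathcal L_q^{1/2}f\|_{L^2}$. By a solution of $$u_{tt}+\mathcal L_q u+a\,u+b\,u_t=0 \text{ on } [0,T]\times(0,1),\quad u(0,\cdot)=u_0,\ u_t(0,\cdot)=u_1,\quad u(t,0)=u(t,1)=0 \qquad (P_{q,a,b,u_0,u_1})$$ we mean a function $u\in C([0,T];W^1_{\mathcal L_q})\cap C^1([0,T];L^2(0,1))$ which satisfies the initial and boundary conditions, and satisfies the equation in the sense that $\frac{d}{dt}\langle u_t,\phi\rangle=-\langle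 u,\mathcal L_q\phi\rangle-\langle au+bu_t,\phi\rangle$ on $[0,T]$ for every $\phi$ in the domain of $\mathcal L_q$. Let $u_0\in L^2(0,1)$ with $u_0''\in L^2(0,1)$ and $u_1\in L^2(0,1)$ be such that a solution $u$ (the classical solution) of $(P_{q,a,b,u_0,u_1})$ exists. Let $(a_\varepsilon),(b_\varepsilon),(q_\varepsilon)$, $\varepsilon\in(0,1]$, be nets of real functions in $L^\infty(0,1)$ and let $(u_{0,\varepsilon}),(u_{1,\varepsilon})$ be nets in $L^2(0,1)$ with $$\|a_\varepsilon-a\|_{L^\infty}\to0,\quad \|b_\varepsilon-b\|_{L^\infty}\to0,\quad \|q_\varepsilon-q\|_{L^\infty}\to0,\quad \|u_{0,\varepsilon}-u_0\|_{L^2}\to0,\quad \|u_{1,\varepsilon}-u_1\|_{L^2}\to0\qquad(\varepsilon\to0).$$ Let the net $(u_\varepsilon)_{\varepsilon\in(0,1]}$ be the very weak solution that belongs to these nets, that is: * $a_\varepsilon,b_\varepsilon\ge0$ for all $\varepsilon\in(0,1]$; * for some $N\in\mathbb N_0$ and $C$, each of $\|a_\varepsilon\|_{L^\infty}$, $\|b_\varepsilon\|_{L^\infty}$,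 $\|q_\varepsilon\|_{L^\infty}$, $\|u_{0,\varepsilon}\|_{L^2}+\|u_{0,\varepsilon}''\|_{L^2}$ and $\|u_{1,\varepsilon}\|_{L^2}$ is at most $C\varepsilon^{-N}$ for all $\varepsilon\in(0,1]$; * for every $\varepsilon\in(0,1]$, $u_\varepsilon$ is a solution of $(P_{q_\varepsilon,a_\varepsilon,b_\varepsilon,u_{0,\varepsilon},u_{1,\varepsilon}})$; * for some $N\in\mathbb N_0$ and $C$, $\sup_{t\in[0,T]}\big(\|u_\varepsilon(t,\cdot)\|_{L^2}+\|\mathcal L_{q_\varepsilon}^{1/2}u_\varepsilon(t,\cdot)\|_{L^2}+\|\partial_tu_\varepsilon(t,\cdot)\|_{L^2}\big)\le C\varepsilon^{-N}$ for all $\varepsilon\in(0,1]$. Then $u_\varepsilon\to u$ in $L^2(0,1)$ uniformly in $t$: $$\sup_{t\in[0,T]}\|u_\varepsilon(t,\cdot)-u(t,\cdot)\|_{L^2(0,1)}\to0\qquad(\varepsilon\to0).$$ -/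

import Mathlib

open MeasureTheory Set Filter Topology
open scoped ENNReal ContDiff

namespace SturmLiouvilleWave

/-- Lebesgue measure on the open unit interval. -/
noncomputable abbrev unitMeasure : Measure ℝ := volume.restrict (Ioo (0 : ℝ) 1)

/-- The complex Hilbert space `L²(0,1)`. -/
abbrev L2 : Type := Lp ℂ 2 unitMeasure

/-- The space `L^∞(0,1)` of real-valued functions; it acts on `L²(0,1)` by multiplication,
`q • f` being the pointwise product. -/
abbrev Linf : Type := Lp ℝ ∞ unitMeasure

/-- `g = f''` on `(0,1)` in the sense of distributions. -/
def IsWeakSecondDeriv (f g : L2) : Prop :=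
  ∀ φ : ℝ → ℂ, ContDiff ℝ ∞ φ → HasCompactSupport φ → tsupport φ ⊆ Ioo (0 : ℝ) 1 →
    ∫ x in Ioo (0 : ℝ) 1, f x * deriv (deriv φ) x = ∫ x in Ioo (0 : ℝ) 1, g x * φ x

/-- `f(0) = f(1) = 0`: the class `f` has a representative that is continuous on `[0,1]` and
vanishes at both end points (a continuous representative on `[0,1]` is unique). -/
def VanishesAtBoundary (f : L2) : Prop :=
  ∃ F : ℝ → ℂ, ContinuousOn F (Icc 0 1) ∧ F =ᵐ[unitMeasure] f ∧ F 0 = 0 ∧ F 1 = 0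

/-- The graph of the Dirichlet Sturm-Liouville operator `𝓛 = -d²/dx² + q` in `L²(0,1)`: `f` lies
in the domain (`f, f'' ∈ L²` and `f(0) = f(1) = 0`) and `𝓛 f = g`. -/
def SLGraph (q : Linf) (f g : L2) : Prop :=
  VanishesAtBoundary f ∧ ∃ f₂ : L2, IsWeakSecondDeriv f f₂ ∧ g = -f₂ + q • f

/-- The graph of the fractional power `𝓛^s`, the operator which multiplies the coefficient along
every eigenfunction `φ` of `𝓛` by `lam ^ s`, where `lam` is the eigenvalue of `φ`: here `f` and
`𝓛^s f = g` are both in `L²`. (For `s > 0` and a negative eigenvalue, of which there are finitely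
many, the principal complex power is used, so that `|lam ^ s| = |lam| ^ s`.) -/
def SLPowGraph (q : Linf) (s : ℝ) (f g : L2) : Prop :=
  ∀ (lam : ℝ) (φ : L2), SLGraph q φ ((lam : ℂ) • φ) →
    inner ℂ φ g = (lam : ℂ) ^ (s : ℂ) * inner ℂ φ f

/-- `u ∈ C([0,T]; W¹_𝓛) ∩ C¹([0,T]; L²)`, with time derivative `v = u_t` and `w = 𝓛^{1/2} u`.
The space `W¹_𝓛` consists of the `f` with `𝓛^{1/2} f ∈ L²` and has the norm `‖𝓛^{1/2} f‖`. -/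
structure InSolutionSpace (T : ℝ) (q : Linf) (u v w : ℝ → L2) : Prop where
  hasDeriv : ∀ t ∈ Icc 0 T, HasDerivWithinAt u (v t) (Icc 0 T) t
  continuousOn_deriv : ContinuousOn v (Icc 0 T)
  sqrt_graph : ∀ t ∈ Icc 0 T, SLPowGraph q (1 / 2) (u t) (w t)
  continuousOn_sqrt : ContinuousOn w (Icc 0 T)

/-- `u ∈ C([0,T]; W¹_𝓛) ∩ C¹([0,T]; L²)` is a solution of the initial/boundary value problem
`u_tt + 𝓛 u + a u + b u_t = 0`, `u(0) = u₀`, `u_t(0) = u₁`, `u(t,0) = u(t,1) = 0`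
on `[0,T] × (0,1)`. The equation is tested against every `φ` in the domain of `𝓛`
(`ψ = 𝓛 φ`):
`d/dt ⟨φ, u_t⟩ = - ⟨𝓛 φ, u⟩ - ⟨φ, a u + b u_t⟩`. -/
def IsSolution (T : ℝ) (q a b : Linf) (u₀ u₁ : L2) (u : ℝ → L2) : Prop :=
  ∃ v w : ℝ → L2, InSolutionSpace T q u v w ∧
    u 0 = u₀ ∧ v 0 = u₁ ∧
    (∀ t ∈ Icc 0 T, VanishesAtBoundary (u t)) ∧
    ∀ φ ψ : L2, SLGraph q φ ψ → ∀ t ∈ Icc 0 T,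
      HasDerivWithinAt (fun τ => inner ℂ φ (v τ))
        (-(inner ℂ ψ (u t)) - inner ℂ φ (a • u t + b • v t)) (Icc 0 T) t

/-- A net `(f_ε)`, `ε ∈ (0,1]`, in a normed space is moderate: `‖f_ε‖ ≤ C ε^{-N}`. -/
def IsModerate {X : Type*} [NormedAddCommGroup X] (f : ℝ → X) : Prop :=
  ∃ (N : ℕ) (C : ℝ), ∀ ε ∈ Ioc (0 : ℝ) 1, ‖f ε‖ ≤ C * (ε ^ N)⁻¹

/-- A net in `L²(0,1)` is `H²`-moderate: `‖f_ε‖ + ‖f_ε''‖ ≤ C ε^{-N}`. -/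
def IsH2Moderate (f : ℝ → L2) : Prop :=
  ∃ (N : ℕ) (C : ℝ), ∀ ε ∈ Ioc (0 : ℝ) 1, ∃ g : L2,
    IsWeakSecondDeriv (f ε) g ∧ ‖f ε‖ + ‖g‖ ≤ C * (ε ^ N)⁻¹

/-- A net `(u_ε)` with `u_ε ∈ C([0,T]; W¹) ∩ C¹([0,T]; L²)` is uniformly `1`-moderate:
`sup_t (‖u_ε(t)‖ + ‖𝓛^{1/2} u_ε(t)‖ + ‖∂_t u_ε(t)‖) ≤ C ε^{-N}`, where `𝓛` is the operator of
the `ε`-dependent problem, that is, the one with potential `q_ε`. -/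
def IsUniformlyModerate (T : ℝ) (q : ℝ → Linf) (u : ℝ → ℝ → L2) : Prop :=
  ∃ (N : ℕ) (C : ℝ), ∀ ε ∈ Ioc (0 : ℝ) 1, ∃ v w : ℝ → L2,
    InSolutionSpace T (q ε) (u ε) v w ∧
      ∀ t ∈ Icc 0 T, ‖u ε t‖ + ‖w t‖ + ‖v t‖ ≤ C * (ε ^ N)⁻¹

/-- The net `(u_ε)`, `ε ∈ (0,1]`, is the very weak solution that belongs to the nets of
coefficients `a_ε, b_ε, q_ε` and of data `u_{0,ε}, u_{1,ε}`. -/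
structure IsVeryWeakSolution (T : ℝ) (q a b : ℝ → Linf) (u₀ u₁ : ℝ → L2)
    (u : ℝ → ℝ → L2) : Prop where
  nonneg_a : ∀ ε ∈ Ioc (0 : ℝ) 1, 0 ≤ a ε
  nonneg_b : ∀ ε ∈ Ioc (0 : ℝ) 1, 0 ≤ b ε
  moderate_a : IsModerate a
  moderate_b : IsModerate b
  moderate_q : IsModerate q
  moderate_u₀ : IsH2Moderate u₀
  moderate_u₁ : IsModerate u₁
  solves : ∀ ε ∈ Ioc (0 : ℝ) 1, IsSolution T (q ε) (a ε) (b ε) (u₀ ε) (u₁ ε) (u ε)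
  moderate : IsUniformlyModerate T q u

end SturmLiouvilleWave

/-! The data converge only in `L²`, so the natural energy of the difference of the two solutions
need not be small at time zero. The remedy is to work one derivative lower: the equation is
integrated once in time and the energy method is applied to the primitive `U = ∫₀ᵗ u`. Sine
functions lie in the domain of `-d²/dx² + q` for every bounded `q`, so they test all the problems at
once. With `L = -d²/dx²`, diagonal in the sine basis, integration gives `U'' + L U = u₁ - (q + a) U
- b (u - u₀)` (`IsSolution.exists_diagonalGraph`). The potential has become a bounded lower order
term: its sign is irrelevant, and `L ≥ 0` does not depend on `ε`. The difference `D` of two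
primitives satisfies `D(0) = 0`, `D'(0) = u₀' - u₀` and `D'' + L D = r`, where `r` is controlled by
`‖D‖`, `‖D'‖` and the differences of data and coefficients. Gronwall
(`DiagonalGraph.energy_estimate`) bounds `‖D'‖ = ‖u' - u‖`, which yields
`IsSolution.exists_stability` and then the limit. -/

namespace SturmLiouvilleWave

/-! ### The sine basis of `L²(0,1)` -/

/-- The `L²`-normalized Dirichlet eigenfunctions `√2 sin((n+1)πx)` of `-d²/dx²`. -/
noncomputable def sineFun (n : ℕ) (x : ℝ) : ℝ := √2 * Real.sin ((n + 1) * Real.pi * x)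

lemma continuous_sineFun (n : ℕ) : Continuous (sineFun n) := by
  unfold sineFun; fun_prop

lemma memLp_sineFun (n : ℕ) : MemLp (fun x => (sineFun n x : ℂ)) 2 unitMeasure := by
  refine MemLp.of_bound (by have := continuous_sineFun n; fun_prop) (√2)
    (Eventually.of_forall fun x => ?_)
  rw [Complex.norm_real, sineFun, norm_mul, Real.norm_of_nonneg (Real.sqrt_nonneg 2)]
  exact mul_le_of_le_one_right (Real.sqrt_nonneg 2) (Real.abs_sin_le_one _)

/-- `sineFun n` as an element of `L²(0,1)`. -/
noncomputable def sineLp (n : ℕ) : L2 := (memLp_sineFun n).toLp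

lemma coeFn_sineLp (n : ℕ) : sineLp n =ᵐ[unitMeasure] fun x => (sineFun n x : ℂ) :=
  MemLp.coeFn_toLp _

/-- The eigenvalue `((n+1)π)²` of `sineFun n`. -/
noncomputable def sineEigenvalue (n : ℕ) : ℝ := ((n + 1) * Real.pi) ^ 2

lemma sineEigenvalue_nonneg (n : ℕ) : 0 ≤ sineEigenvalue n := sq_nonneg _

lemma vanishesAtBoundary_sineLp (n : ℕ) : VanishesAtBoundary (sineLp n) := by
  refine ⟨fun x => (sineFun n x : ℂ), ?_, (coeFn_sineLp n).symm, ?_, ?_⟩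
  · have := continuous_sineFun n
    exact Continuous.continuousOn (by fun_prop)
  · simp [sineFun]
  · have := Real.sin_nat_mul_pi (n + 1)
    push_cast at this
    simp [sineFun, this]

lemma integral_sineFun_mul_deriv_deriv (n : ℕ) (φ : ℝ → ℂ) (hφ : ContDiff ℝ ∞ φ)
    (hs : tsupport φ ⊆ Ioo (0 : ℝ) 1) :
    ∫ x in Ioo (0 : ℝ) 1, (sineFun n x : ℂ) * deriv (deriv φ) x =
      ∫ x in Ioo (0 : ℝ) 1, -((sineEigenvalue n : ℂ) * sineFun n x) * φ x := by
  have h1 : ContDiff ℝ ∞ (deriv φ) := hφ.deriv'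
  have h2 : ContDiff ℝ ∞ (deriv (deriv φ)) := h1.deriv'
  have d1 : ∀ x, HasDerivAt φ (deriv φ x) x := fun x =>
    (hφ.differentiable (by simp)).differentiableAt.hasDerivAt
  have d2 : ∀ x, HasDerivAt (deriv φ) (deriv (deriv φ) x) x := fun x =>
    (h1.differentiable (by simp)).differentiableAt.hasDerivAt
  have z : ∀ x, x ∉ Ioo (0 : ℝ) 1 → φ x = 0 ∧ deriv φ x = 0 := fun x hx =>
    ⟨image_eq_zero_of_notMem_tsupport fun h => hx (hs h),
      image_eq_zero_of_notMem_tsupport fun h => hx (hs (closure_minimal (support_deriv_subset)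
        (isClosed_tsupport φ) h))⟩
  set k : ℝ := (n + 1) * Real.pi with hk
  have s1 : ∀ x, HasDerivAt (fun x => (sineFun n x : ℂ)) ((√2 * (Real.cos (k * x) * k) : ℝ) : ℂ) x := by
    intro x
    refine HasDerivAt.ofReal_comp (HasDerivAt.const_mul _ ?_)
    simpa using ((hasDerivAt_id x).const_mul k).sin
  have s2 : ∀ x, HasDerivAt (fun x => ((√2 * (Real.cos (k * x) * k) : ℝ) : ℂ))
      (-((sineEigenvalue n : ℂ) * sineFun n x)) x := by
    intro x
    have : HasDerivAt (fun x => √2 * (Real.cos (k * x) * k)) (√2 * (-Real.sin (k * x) * k * k)) x := by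
      refine HasDerivAt.const_mul _ (HasDerivAt.mul_const ?_ _)
      simpa using ((hasDerivAt_id x).const_mul k).cos
    convert this.ofReal_comp using 1
    simp only [sineEigenvalue, sineFun, ← hk]
    push_cast; ring
  have cs := continuous_sineFun n
  have i1 : IntervalIntegrable (fun x => (sineFun n x : ℂ) * deriv (deriv φ) x) volume 0 1 :=
    Continuous.intervalIntegrable (by have := h2.continuous; fun_prop) _ _
  have i2 : IntervalIntegrable (fun x => -((sineEigenvalue n : ℂ) * sineFun n x) * φ x)
      volume 0 1 :=
    Continuous.intervalIntegrable (by have := hφ.continuous; fun_prop) _ _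
  -- Green's identity: `s φ'' - s'' φ` is the derivative of `s φ' - s' φ`, which vanishes at both
  -- end points because `φ` and `φ'` do.
  have key := intervalIntegral.integral_eq_sub_of_hasDerivAt (a := 0) (b := 1)
    (f := fun x => (sineFun n x : ℂ) * deriv φ x - ((√2 * (Real.cos (k * x) * k) : ℝ) : ℂ) * φ x)
    (f' := fun x => (sineFun n x : ℂ) * deriv (deriv φ) x
      - -((sineEigenvalue n : ℂ) * sineFun n x) * φ x)
    (fun x _ => (((s1 x).mul (d2 x)).sub ((s2 x).mul (d1 x))).congr_deriv (by ring)) (i1.sub i2)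
  rw [intervalIntegral.integral_sub i1 i2] at key
  simp only [(z 0 (by simp)).1, (z 0 (by simp)).2, (z 1 (by simp)).1, (z 1 (by simp)).2,
    mul_zero, sub_zero] at key
  simpa [← integral_Ioc_eq_integral_Ioo, ← intervalIntegral.integral_of_le] using sub_eq_zero.mp key

lemma isWeakSecondDeriv_sineLp (n : ℕ) :
    IsWeakSecondDeriv (sineLp n) (-((sineEigenvalue n : ℂ) • sineLp n)) := by
  intro φ hφ _ hs
  have h := integral_sineFun_mul_deriv_deriv n φ hφ hs
  calc _ = _ := integral_congr_ae ?_
    _ = _ := h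
    _ = _ := integral_congr_ae ?_
  · filter_upwards [coeFn_sineLp n] with x hx
    rw [hx]
  · filter_upwards [coeFn_sineLp n, Lp.coeFn_neg ((sineEigenvalue n : ℂ) • sineLp n),
      Lp.coeFn_smul (sineEigenvalue n : ℂ) (sineLp n)] with x h1 h2 h3
    rw [h2, Pi.neg_apply, h3, Pi.smul_apply, h1, smul_eq_mul]

/-- Sines are eigenfunctions only for `q = 0`, but they are admissible test functions for every `q`.
-/
lemma slGraph_sineLp (q : Linf) (n : ℕ) :
    SLGraph q (sineLp n) ((sineEigenvalue n : ℂ) • sineLp n + q • sineLp n) :=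
  ⟨vanishesAtBoundary_sineLp n, _, isWeakSecondDeriv_sineLp n, by rw [neg_neg]⟩

lemma inner_sineLp (n : ℕ) (f : L2) :
    inner ℂ (sineLp n) f = ∫ x in Ioo (0 : ℝ) 1, f x * (sineFun n x : ℂ) := by
  rw [L2.inner_def]
  refine integral_congr_ae ?_
  filter_upwards [coeFn_sineLp n] with x hx
  rw [hx]
  simp

lemma integral_cos_int_mul_pi (k : ℤ) :
    ∫ x in (0 : ℝ)..1, Real.cos (k * Real.pi * x) = if k = 0 then 1 else 0 := by
  split_ifs with h
  · simp [h]
  · have : (k : ℝ) * Real.pi ≠ 0 := mul_ne_zero (by exact_mod_cast h) Real.pi_ne_zero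
    rw [intervalIntegral.integral_comp_mul_left _ this]
    simp [Real.sin_int_mul_pi]

lemma orthonormal_sineLp : Orthonormal ℂ sineLp := by
  rw [orthonormal_iff_ite]
  intro m n
  rw [inner_sineLp]
  have h : ∀ᵐ x ∂unitMeasure, (sineLp n) x * (sineFun m x : ℂ) =
      ((Real.cos (((m - n : ℤ) : ℝ) * Real.pi * x)
        - Real.cos (((m + n + 2 : ℤ) : ℝ) * Real.pi * x) : ℝ) : ℂ) := by
    filter_upwards [coeFn_sineLp n] with x hx
    rw [hx, ← Complex.ofReal_mul]
    congr 1
    have e1 : ((m - n : ℤ) : ℝ) * Real.pi * x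
        = (m + 1) * Real.pi * x - (n + 1) * Real.pi * x := by push_cast; ring
    have e2 : ((m + n + 2 : ℤ) : ℝ) * Real.pi * x
        = (m + 1) * Real.pi * x + (n + 1) * Real.pi * x := by push_cast; ring
    rw [e1, e2, Real.cos_sub, Real.cos_add, sineFun, sineFun]
    have := Real.mul_self_sqrt (show (0 : ℝ) ≤ 2 by norm_num)
    linear_combination (Real.sin ((n + 1) * Real.pi * x) * Real.sin ((m + 1) * Real.pi * x)) * this
  rw [integral_congr_ae h, integral_complex_ofReal, ← integral_Ioc_eq_integral_Ioo,
    ← intervalIntegral.integral_of_le zero_le_one, intervalIntegral.integral_sub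
    (Continuous.intervalIntegrable (by fun_prop) _ _)
    (Continuous.intervalIntegrable (by fun_prop) _ _), integral_cos_int_mul_pi,
    integral_cos_int_mul_pi, if_neg (show (m + n + 2 : ℤ) ≠ 0 by omega)]
  by_cases hmn : m = n
  · simp [hmn]
  · rw [if_neg (by omega), if_neg hmn]; simp

/-! ### Completeness of the sine system -/

lemma L2.integrable_mul_ofReal (f : L2) {g : ℝ → ℝ} (hg : Continuous g) :
    Integrable (fun x => f x * (g x : ℂ)) unitMeasure := by
  have hf : Integrable f unitMeasure := (Lp.memLp f).integrable (by norm_num)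
  obtain ⟨C, hC⟩ := (isCompact_Icc (a := (0 : ℝ)) (b := 1)).exists_bound_of_continuousOn
    hg.continuousOn
  refine hf.mul_bdd (c := C) (by fun_prop) ?_
  filter_upwards [ae_restrict_mem measurableSet_Ioo] with x hx
  simpa using hC x (Ioo_subset_Icc_self hx)

/-- Each factor `cos πx` is absorbed by `2 sin(kθ) cos θ = sin((k+1)θ) + sin((k-1)θ)`; the induction
on `m` therefore needs all `k` at once. -/
lemma integral_mul_sin_mul_cos_pow_eq_zero (f : L2) (hf : ∀ n, inner ℂ (sineLp n) f = 0) (m : ℕ) :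
    ∀ k : ℕ, ∫ x in Ioo (0 : ℝ) 1,
      f x * ((Real.sin (k * Real.pi * x) * Real.cos (Real.pi * x) ^ m : ℝ) : ℂ) = 0 := by
  induction m with
  | zero =>
    rintro (_ | k)
    · simp
    · have := hf k
      rw [inner_sineLp] at this
      have e : ∀ x : ℝ, f x * (sineFun k x : ℂ) = ((√2 : ℝ) : ℂ) *
          (f x * ((Real.sin (((k + 1 : ℕ) : ℝ) * Real.pi * x) * Real.cos (Real.pi * x) ^ 0 : ℝ) : ℂ)) := by
        intro x
        simp only [sineFun]; push_cast; ring
      simp_rw [e] at this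
      rw [integral_const_mul] at this
      exact (mul_eq_zero.mp this).resolve_left (by simp)
  | succ m ih =>
    rintro (_ | k)
    · simp
    · have e : ∀ x : ℝ, f x * ((Real.sin (((k + 1 : ℕ) : ℝ) * Real.pi * x)
          * Real.cos (Real.pi * x) ^ (m + 1) : ℝ) : ℂ) = (1 / 2 : ℂ) *
          (f x * ((Real.sin (((k + 2 : ℕ) : ℝ) * Real.pi * x) * Real.cos (Real.pi * x) ^ m : ℝ) : ℂ)
          + f x * ((Real.sin ((k : ℝ) * Real.pi * x) * Real.cos (Real.pi * x) ^ m : ℝ) : ℂ)) := by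
        intro x
        have e1 : ((k + 2 : ℕ) : ℝ) * Real.pi * x
          = ((k + 1 : ℕ) : ℝ) * Real.pi * x + Real.pi * x := by push_cast; ring
        have e2 : (k : ℝ) * Real.pi * x
          = ((k + 1 : ℕ) : ℝ) * Real.pi * x - Real.pi * x := by push_cast; ring
        rw [e1, e2, Real.sin_add, Real.sin_sub]
        push_cast
        ring
      simp_rw [e]
      rw [integral_const_mul, integral_add (L2.integrable_mul_ofReal f (by fun_prop))
        (L2.integrable_mul_ofReal f (by fun_prop)), ih, ih]
      simp

lemma integral_mul_sin_mul_polynomial_eq_zero (f : L2) (hf : ∀ n, inner ℂ (sineLp n) f = 0)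
    (p : Polynomial ℝ) : ∫ x in Ioo (0 : ℝ) 1,
      f x * ((Real.sin (Real.pi * x) * p.eval (Real.cos (Real.pi * x)) : ℝ) : ℂ) = 0 := by
  induction p using Polynomial.induction_on' with
  | add p r hp hr =>
    simp_rw [Polynomial.eval_add, mul_add, Complex.ofReal_add, mul_add]
    rw [integral_add (L2.integrable_mul_ofReal f (by fun_prop))
        (L2.integrable_mul_ofReal f (by fun_prop)), hp, hr, add_zero]
  | monomial n c =>
    have := integral_mul_sin_mul_cos_pow_eq_zero f hf n 1
    have e : ∀ x : ℝ, f x * ((Real.sin (Real.pi * x) *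
        (Polynomial.monomial n c).eval (Real.cos (Real.pi * x)) : ℝ) : ℂ) = (c : ℂ) *
        (f x * ((Real.sin (((1 : ℕ) : ℝ) * Real.pi * x) * Real.cos (Real.pi * x) ^ n : ℝ) : ℂ)) := by
      intro x
      simp only [Polynomial.eval_monomial]; push_cast; ring_nf
    simp_rw [e]
    rw [integral_const_mul, this, mul_zero]

/-- Since `cos πx` maps `[0,1]` bijectively onto `[-1,1]`, Weierstrass approximation in the variable
`y = cos πx` passes from polynomials in `cos πx` to continuous functions. -/
lemma integral_mul_sin_mul_continuous_eq_zero (f : L2) (hf : ∀ n, inner ℂ (sineLp n) f = 0)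
    {g : ℝ → ℝ} (hg : Continuous g) : ∫ x in Ioo (0 : ℝ) 1,
      f x * ((Real.sin (Real.pi * x) * g x : ℝ) : ℂ) = 0 := by
  have hfi : Integrable f unitMeasure := (Lp.memLp f).integrable (by norm_num)
  set M := ∫ x in Ioo (0 : ℝ) 1, ‖f x‖ with hM
  have hM0 : 0 ≤ M := integral_nonneg fun x => norm_nonneg _
  rw [← norm_le_zero_iff]
  refine le_of_forall_pos_le_add fun δ hδ => ?_
  obtain ⟨p, hp⟩ := exists_polynomial_near_of_continuousOn (-1) 1
    (fun y => g (Real.arccos y / Real.pi)) (by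
      have := Real.continuous_arccos
      exact Continuous.continuousOn (by fun_prop)) (δ / (M + 1)) (by positivity)
  have key : ∫ x in Ioo (0 : ℝ) 1, f x * ((Real.sin (Real.pi * x) * g x : ℝ) : ℂ) =
      ∫ x in Ioo (0 : ℝ) 1, f x * ((Real.sin (Real.pi * x) *
        (g x - p.eval (Real.cos (Real.pi * x))) : ℝ) : ℂ) := by
    simp_rw [mul_sub, Complex.ofReal_sub, mul_sub]
    rw [integral_sub (L2.integrable_mul_ofReal f (by fun_prop))
        (L2.integrable_mul_ofReal f (by fun_prop)),
        integral_mul_sin_mul_polynomial_eq_zero f hf p, sub_zero]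
  rw [key, zero_add]
  calc _ ≤ ∫ x in Ioo (0 : ℝ) 1, ‖f x‖ * (δ / (M + 1)) := by
        refine norm_integral_le_of_norm_le (hfi.norm.mul_const _) ?_
        filter_upwards [ae_restrict_mem measurableSet_Ioo] with x hx
        rw [norm_mul, Complex.norm_real, norm_mul]
        have h := hp (Real.cos (Real.pi * x)) ⟨Real.neg_one_le_cos _, Real.cos_le_one _⟩
        rw [Real.arccos_cos (by have := Real.pi_pos; nlinarith [hx.1])
          (by have := Real.pi_pos; nlinarith [hx.2]), mul_div_cancel_left₀ _ Real.pi_ne_zero,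
          abs_sub_comm] at h
        gcongr
        calc _ ≤ 1 * (δ / (M + 1)) := by
              gcongr
              · exact Real.abs_sin_le_one _
              · exact h.le
          _ = _ := one_mul _
    _ = M * (δ / (M + 1)) := integral_mul_const _ _
    _ ≤ δ := by
      rw [mul_div_assoc', div_le_iff₀ (by positivity)]
      nlinarith

/-- The function `f sin πx` annihilates all test functions, hence vanishes almost everywhere, and
`sin πx > 0` on `(0,1)`. -/
lemma eq_zero_of_inner_sineLp_eq_zero (f : L2) (hf : ∀ n, inner ℂ (sineLp n) f = 0) : f = 0 := by
  have hloc : LocallyIntegrableOn (fun x => f x * ((Real.sin (Real.pi * x) : ℝ) : ℂ))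
      (Ioo (0 : ℝ) 1) volume :=
    IntegrableOn.locallyIntegrableOn (L2.integrable_mul_ofReal f (by fun_prop))
  have h := isOpen_Ioo.ae_eq_zero_of_integral_contDiff_smul_eq_zero hloc (by
    intro g hg _ hs
    rw [← setIntegral_eq_integral_of_forall_compl_eq_zero (s := Ioo (0 : ℝ) 1)
      (fun x hx => by rw [image_eq_zero_of_notMem_tsupport fun h => hx (hs h), zero_smul])]
    rw [← integral_mul_sin_mul_continuous_eq_zero f hf hg.continuous]
    refine integral_congr_ae (Eventually.of_forall fun x => ?_)
    simp only [Complex.real_smul]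
    push_cast
    ring)
  rw [← ae_restrict_iff' measurableSet_Ioo] at h
  refine (Lp.eq_zero_iff_ae_eq_zero).mpr ?_
  filter_upwards [h, ae_restrict_mem measurableSet_Ioo] with x hx hx01
  refine (mul_eq_zero.mp hx).resolve_right ?_
  have := Real.pi_pos
  exact Complex.ofReal_ne_zero.mpr (Real.sin_pos_of_pos_of_lt_pi (mul_pos this hx01.1) (by nlinarith [hx01.2])).ne'

/-- The Hilbert basis `√2 sin((n+1)πx)` of `L²(0,1)`. -/
noncomputable def sineBasis : HilbertBasis ℕ ℂ L2 :=
  HilbertBasis.mkOfOrthogonalEqBot orthonormal_sineLp (by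
    rw [Submodule.eq_bot_iff]
    intro f hf
    refine eq_zero_of_inner_sineLp_eq_zero f fun n => ?_
    exact hf _ (Submodule.subset_span ⟨n, rfl⟩))

lemma sineBasis_apply (n : ℕ) : sineBasis n = sineLp n :=
  congrFun (HilbertBasis.coe_mkOfOrthogonalEqBot _ _) n

end SturmLiouvilleWave
namespace SturmLiouvilleWave

/-! ### Energy estimate for operators that are diagonal in a Hilbert basis -/

section Diagonal

variable {ι E : Type*} [NormedAddCommGroup E] [InnerProductSpace ℂ E]

/-- `y` is the image of `x` under the operator with eigenvectors `B i` and eigenvalues `lam i`. -/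
def DiagonalGraph (B : HilbertBasis ι ℂ E) (lam : ι → ℝ) (x y : E) : Prop :=
  ∀ i, inner ℂ (B i) y = (lam i : ℂ) * inner ℂ (B i) x

variable {B : HilbertBasis ι ℂ E} {lam : ι → ℝ}

lemma DiagonalGraph.sub {x y x' y' : E} (h : DiagonalGraph B lam x y)
    (h' : DiagonalGraph B lam x' y') : DiagonalGraph B lam (x - x') (y - y') := fun i => by
  rw [inner_sub_right, inner_sub_right, h i, h' i, mul_sub]

/-- Parseval together with real eigenvalues: the diagonal operator is symmetric. -/
lemma DiagonalGraph.inner_comm {x y x' y' : E} (h : DiagonalGraph B lam x y)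
    (h' : DiagonalGraph B lam x' y') : inner ℂ x y' = inner ℂ y x' := by
  rw [← B.tsum_inner_mul_inner x y', ← B.tsum_inner_mul_inner y x']
  refine tsum_congr fun i => ?_
  rw [h' i, ← inner_conj_symm y, h i, map_mul, Complex.conj_ofReal, inner_conj_symm]
  ring

lemma DiagonalGraph.re_inner_nonneg (hlam : ∀ i, 0 ≤ lam i) {x y : E}
    (h : DiagonalGraph B lam x y) : 0 ≤ (inner ℂ x y).re := by
  have hs := Complex.hasSum_re (B.hasSum_inner_mul_inner x y)
  refine hs.nonneg fun i => ?_
  rw [h i, ← inner_conj_symm x, mul_left_comm, ← Complex.normSq_eq_conj_mul_self,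
    ← Complex.ofReal_mul, Complex.ofReal_re]
  exact mul_nonneg (hlam i) (Complex.normSq_nonneg _)

variable [NormedSpace ℝ E] [IsScalarTower ℝ ℂ E]

/-- `H` is only continuous, so the product rule is unavailable. By symmetry the increment of `Re ⟨D,
H⟩` equals `Re ⟨D z - D t, H z + H t⟩`, whose difference quotient involves the slope of `D` alone.
-/
lemma DiagonalGraph.hasDerivWithinAt_re_inner {D H : ℝ → E} {d : E} {s : Set ℝ} {t : ℝ}
    (hDH : ∀ z ∈ s, DiagonalGraph B lam (D z) (H z)) (ht : t ∈ s)
    (hD : HasDerivWithinAt D d s t) (hH : ContinuousWithinAt H s t) :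
    HasDerivWithinAt (fun z => (inner ℂ (D z) (H z)).re) (2 * (inner ℂ d (H t)).re) s t := by
  rw [hasDerivWithinAt_iff_tendsto_slope] at hD ⊢
  have hH' : Tendsto (fun z => H z + H t) (𝓝[s \ {t}] t) (𝓝 (H t + H t)) :=
    (hH.mono sdiff_subset).add_const _
  have h := (Complex.continuous_re.tendsto _).comp (hD.inner (𝕜 := ℂ) hH')
  have e : (inner ℂ d (H t + H t)).re = 2 * (inner ℂ d (H t)).re := by
    rw [inner_add_right, Complex.add_re, two_mul]
  rw [e] at h
  refine h.congr' ?_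
  filter_upwards [self_mem_nhdsWithin] with z hz
  have h1 : (inner ℂ (D z) (H t)).re = (inner ℂ (D t) (H z)).re := by
    rw [(hDH z hz.1).inner_comm (hDH t ht), ← inner_conj_symm, Complex.conj_re]
  rw [Function.comp_apply, slope_def_module, slope_def_module, smul_eq_mul,
    ← algebraMap_smul ℂ, Complex.coe_algebraMap, inner_smul_left, Complex.conj_ofReal, Complex.re_ofReal_mul]
  simp only [inner_add_right, inner_sub_left, Complex.add_re, Complex.sub_re]
  rw [h1]
  ring

lemma hasDerivWithinAt_re_inner_self {d : ℝ → E} {e : E} {s : Set ℝ} {t : ℝ}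
    (hd : HasDerivWithinAt d e s t) :
    HasDerivWithinAt (fun z => ‖d z‖ ^ 2) (2 * (inner ℂ (d t) e).re) s t := by
  rw [hasDerivWithinAt_iff_tendsto_slope]
  have hd' := hd.continuousWithinAt
  rw [hasDerivWithinAt_iff_tendsto_slope] at hd
  have hH' : Tendsto (fun z => d z + d t) (𝓝[s \ {t}] t) (𝓝 (d t + d t)) :=
    (hd'.mono sdiff_subset).add_const _
  have h := (Complex.continuous_re.tendsto _).comp (hH'.inner (𝕜 := ℂ) hd)
  have e : (inner ℂ (d t + d t) e).re = 2 * (inner ℂ (d t) e).re := by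
    rw [inner_add_left, Complex.add_re, two_mul]
  rw [e] at h
  refine h.congr fun z => ?_
  have h1 : (inner ℂ (d z) (d t)).re = (inner ℂ (d t) (d z)).re := by
    rw [← inner_conj_symm, Complex.conj_re]
  have h2 : ∀ x : E, ‖x‖ ^ 2 = (inner ℂ x x).re := fun x => (inner_self_eq_norm_sq (𝕜 := ℂ) x).symm
  rw [Function.comp_apply, slope_def_module, slope_def_module, smul_eq_mul,
    ← algebraMap_smul ℂ, Complex.coe_algebraMap, inner_smul_right, Complex.re_ofReal_mul, h2, h2]
  simp only [inner_add_left, inner_sub_right, Complex.add_re, Complex.sub_re]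
  rw [h1]
  ring

/-- Energy estimate for `D'' + L D = r` with `D(0) = 0`, where `L ≥ 0` is diagonal and
`‖r‖ ≤ g + M ‖D‖ + M ‖D'‖`; here `d = D'`, `e = D''` and `H = L D`. -/
theorem DiagonalGraph.energy_estimate (hlam : ∀ i, 0 ≤ lam i) {T M g : ℝ} (hM : 0 ≤ M)
    {D d e H : ℝ → E}
    (hD : ∀ t ∈ Icc 0 T, HasDerivWithinAt D (d t) (Icc 0 T) t)
    (hd : ∀ t ∈ Icc 0 T, HasDerivWithinAt d (e t) (Icc 0 T) t)
    (hH : ContinuousOn H (Icc 0 T))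
    (hDH : ∀ t ∈ Icc 0 T, DiagonalGraph B lam (D t) (H t)) (hD0 : D 0 = 0)
    (hr : ∀ t ∈ Icc 0 T, ‖e t + H t‖ ≤ g + M * ‖D t‖ + M * ‖d t‖) :
    ∀ t ∈ Icc 0 T, ‖d t‖ ^ 2 ≤ (‖d 0‖ ^ 2 + g ^ 2) * Real.exp ((3 * M + 2) * T) := by
  -- The term `‖D‖²` is added to the energy because `lam ≥ 0` alone gives no control of the `M ‖D‖`
  -- in the bound for the right-hand side.
  set Φ : ℝ → ℝ := fun t => ‖d t‖ ^ 2 + (inner ℂ (D t) (H t)).re + ‖D t‖ ^ 2 with hΦ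
  have hΦ' : ∀ t ∈ Icc 0 T,
      HasDerivWithinAt Φ (2 * (inner ℂ (d t) (e t + H t + D t)).re) (Icc 0 T) t := by
    intro t ht
    refine (((hasDerivWithinAt_re_inner_self (hd t ht)).add
      (DiagonalGraph.hasDerivWithinAt_re_inner hDH ht (hD t ht) (hH t ht))).add
      (hasDerivWithinAt_re_inner_self (hD t ht))).congr_deriv ?_
    have h1 : (inner ℂ (D t) (d t)).re = (inner ℂ (d t) (D t)).re := by
      rw [← inner_conj_symm, Complex.conj_re]
    rw [inner_add_right, inner_add_right, Complex.add_re, Complex.add_re, h1]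
    ring
  have hbound : ∀ t ∈ Icc 0 T,
      2 * (inner ℂ (d t) (e t + H t + D t)).re ≤ (3 * M + 2) * Φ t + g ^ 2 := by
    intro t ht
    have h0 := (hDH t ht).re_inner_nonneg hlam
    have h1 : (inner ℂ (d t) (e t + H t + D t)).re ≤
        ‖d t‖ * (g + M * ‖D t‖ + M * ‖d t‖ + ‖D t‖) :=
      (re_inner_le_norm (𝕜 := ℂ) _ _).trans
        (mul_le_mul_of_nonneg_left ((norm_add_le _ _).trans (by gcongr; exact hr t ht))
          (norm_nonneg _))
    have h2 : 0 ≤ (3 * M + 2) * (inner ℂ (D t) (H t)).re := by positivity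
    have h3 : 0 ≤ M * (‖d t‖ - ‖D t‖) ^ 2 := by positivity
    have h4 : 0 ≤ M * ‖D t‖ ^ 2 := by positivity
    simp only [hΦ]
    -- Young's inequality on each product: `‖d‖²` collects `1 + M + 2M + 1 = 3M + 2`, `‖D‖²` only `M
    -- + 1`.
    nlinarith [sq_nonneg (‖d t‖ - g), sq_nonneg (‖d t‖ - ‖D t‖), sq_nonneg ‖D t‖]
  have hgr := le_gronwallBound_of_liminf_deriv_right_le (f := Φ) (δ := ‖d 0‖ ^ 2)
    (fun t ht => (hΦ' t ht).continuousWithinAt)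
    (fun t ht r hr => (((hΦ' t (Ico_subset_Icc_self ht)).mono_of_mem_nhdsWithin
      (Icc_mem_nhdsGE_of_mem ht)).liminf_right_slope_le hr))
    (by simp [hΦ, hD0]) (fun t ht => hbound t (Ico_subset_Icc_self ht))
  intro t ht
  have h0 := (hDH t ht).re_inner_nonneg hlam
  have hle : ‖d t‖ ^ 2 ≤ Φ t := by simp only [hΦ]; nlinarith [sq_nonneg ‖D t‖]
  refine hle.trans ((hgr t ht).trans ?_)
  rw [gronwallBound_of_K_ne_0 (by positivity), sub_zero]
  have hexp : Real.exp ((3 * M + 2) * t) ≤ Real.exp ((3 * M + 2) * T) := by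
    gcongr; exact ht.2
  have h5 : g ^ 2 / (3 * M + 2) ≤ g ^ 2 := div_le_self (sq_nonneg g) (by linarith)
  have h6 : 1 ≤ Real.exp ((3 * M + 2) * t) := Real.one_le_exp (mul_nonneg (by positivity) ht.1)
  calc _ ≤ ‖d 0‖ ^ 2 * Real.exp ((3 * M + 2) * t) + g ^ 2 * Real.exp ((3 * M + 2) * t) := by
        beta_reduce
        exact add_le_add_right (mul_le_mul h5 (sub_le_self _ zero_le_one) (sub_nonneg.mpr h6)
          (sq_nonneg g)) _
    _ = (‖d 0‖ ^ 2 + g ^ 2) * Real.exp ((3 * M + 2) * t) := by ring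
    _ ≤ _ := by gcongr

end Diagonal

/-! ### Solutions integrated in time -/

/-- Multiplication by an `L^∞` function as a bounded operator on `L²(0,1)`. -/
noncomputable def mulCLM (q : Linf) : L2 →L[ℂ] L2 :=
  LinearMap.mkContinuous
    { toFun := fun f => q • f
      map_add' := fun f g => Lp.add_smul q f g
      map_smul' := fun c f => by
        refine Lp.ext ?_
        filter_upwards [Lp.coeFn_lpSMul (r := 2) q (c • f), Lp.coeFn_smul c (q • f : L2),
          Lp.coeFn_lpSMul (r := 2) q f, Lp.coeFn_smul c f] with x h1 h2 h3 h4
        simp only [RingHom.id_apply, h1, h2, h3, h4, Pi.smul_apply', Pi.smul_apply]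
        exact smul_comm _ _ _ } ‖q‖ (fun f => Lp.norm_smul_le q f)

lemma mulCLM_apply (q : Linf) (f : L2) : mulCLM q f = q • f := rfl

lemma inner_smul_comm (q : Linf) (f g : L2) :
    inner ℂ f (q • g) = (inner ℂ (q • f) g : ℂ) := by
  rw [L2.inner_def, L2.inner_def]
  refine integral_congr_ae ?_
  filter_upwards [Lp.coeFn_lpSMul (r := 2) q f, Lp.coeFn_lpSMul (r := 2) q g] with x hf hg
  simp only [hf, hg, Pi.smul_apply']
  simp only [RCLike.inner_apply, Complex.real_smul, map_mul, Complex.conj_ofReal]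
  ring

/-- Integrating the equation once in time expresses `-U''` for the primitive `U` of `u` through
lower order terms. -/
lemma IsSolution.exists_diagonalGraph {T : ℝ} {q a b : Linf} {u₀ u₁ : L2} {u U : ℝ → L2}
    (hu : IsSolution T q a b u₀ u₁ u) (hU0 : U 0 = 0)
    (hU : ∀ t ∈ Icc 0 T, HasDerivWithinAt U (u t) (Icc 0 T) t) :
    ∃ v : ℝ → L2, (∀ t ∈ Icc 0 T, HasDerivWithinAt u (v t) (Icc 0 T) t) ∧
      ContinuousOn v (Icc 0 T) ∧ u 0 = u₀ ∧
      ∀ t ∈ Icc 0 T, DiagonalGraph sineBasis sineEigenvalue (U t)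
        (-(v t - u₁ + (mulCLM q (U t) + mulCLM a (U t)) + mulCLM b (u t - u₀))) := by
  obtain ⟨v, w, hsp, h0, h1, -, heq⟩ := hu
  refine ⟨v, hsp.hasDeriv, hsp.continuousOn_deriv, h0, fun t ht n => ?_⟩
  rw [sineBasis_apply]
  set φ := sineLp n
  set lam := sineEigenvalue n
  have hin : ∀ {f : ℝ → L2} {f' : L2} {s : ℝ}, HasDerivWithinAt f f' (Icc 0 T) s →
      HasDerivWithinAt (fun τ => (inner ℂ φ (f τ) : ℂ)) (inner ℂ φ f') (Icc 0 T) s := fun h =>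
    ((innerSL ℂ φ).restrictScalars ℝ).hasFDerivAt.comp_hasDerivWithinAt _ h
  have hmul : ∀ (p : Linf) {f : ℝ → L2} {f' : L2} {s : ℝ}, HasDerivWithinAt f f' (Icc 0 T) s →
      HasDerivWithinAt (fun τ => mulCLM p (f τ)) (mulCLM p f') (Icc 0 T) s := fun p _ _ _ h =>
    ((mulCLM p).restrictScalars ℝ).hasFDerivAt.comp_hasDerivWithinAt _ h
  -- A conserved quantity: the weak equation tested with `φ` says that `G' = 0`, once the factor `q`
  -- in `𝓛 φ = lam φ + q φ` is moved to the other side of the inner product. Its value at time zero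
  -- supplies the terms with `u₁` and `u₀`.
  set G : ℝ → ℂ := fun τ => inner ℂ φ (v τ) + inner ℂ φ (mulCLM q (U τ) + mulCLM a (U τ))
      + inner ℂ φ (mulCLM b (u τ)) + (lam : ℂ) * inner ℂ φ (U τ) with hG
  have hG' : ∀ s ∈ Icc 0 T, HasDerivWithinAt G 0 (Icc 0 T) s := by
    intro s hs
    refine ((((heq φ _ (slGraph_sineLp q n) s hs).add
      (hin ((hmul q (hU s hs)).add (hmul a (hU s hs))))).add
      (hin (hmul b (hsp.hasDeriv s hs)))).add ((hin (hU s hs)).const_mul (lam : ℂ))).congr_deriv ?_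
    rw [inner_add_left, inner_smul_left, ← inner_smul_comm, Complex.conj_ofReal]
    simp only [mulCLM_apply, inner_add_right]
    ring
  have hconst := constant_of_has_deriv_right_zero (fun s hs => (hG' s hs).continuousWithinAt)
    (fun s hs => (hG' s (Ico_subset_Icc_self hs)).mono_of_mem_nhdsWithin
      (Icc_mem_nhdsGE_of_mem hs)) t ht
  simp only [hG, h0, h1, hU0, map_zero, add_zero, inner_zero_right, mul_zero] at hconst
  simp only [inner_neg_right, inner_add_right, inner_sub_right, map_sub] at hconst ⊢
  linear_combination -hconst

lemma exists_primitive {T : ℝ} (hT : 0 ≤ T) {u : ℝ → L2} (hu : ContinuousOn u (Icc 0 T)) :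
    ∃ U : ℝ → L2, U 0 = 0 ∧ ∀ t ∈ Icc 0 T, HasDerivWithinAt U (u t) (Icc 0 T) t := by
  have hc : Continuous (IccExtend hT ((Icc 0 T).domRestrict u)) :=
    (continuousOn_iff_continuous_domRestrict.mp hu).Icc_extend'
  refine ⟨fun t => ∫ s in (0 : ℝ)..t, IccExtend hT ((Icc 0 T).domRestrict u) s, by simp,
    fun t ht => ?_⟩
  have := (hc.integral_hasStrictDerivAt 0 t).hasDerivAt.hasDerivWithinAt (s := Icc 0 T)
  rwa [IccExtend_of_mem hT _ ht] at this

lemma IsSolution.continuousOn {T : ℝ} {q a b : Linf} {u₀ u₁ : L2} {u : ℝ → L2}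
    (hu : IsSolution T q a b u₀ u₁ u) : ContinuousOn u (Icc 0 T) := by
  obtain ⟨v, w, hsp, -⟩ := hu
  exact fun t ht => (hsp.hasDeriv t ht).continuousWithinAt

/-! ### Stability under perturbation of coefficients and data -/

lemma mulCLM_sub_sub_mulCLM (p p' : Linf) (f f' : L2) :
    mulCLM p' f' - mulCLM p f = mulCLM p' (f' - f) + mulCLM (p' - p) f := by
  have h : mulCLM (p' - p) f = mulCLM p' f - mulCLM p f := by
    simp only [mulCLM_apply, sub_eq_add_neg, Lp.smul_add, Lp.neg_smul]
  rw [h, map_sub]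
  abel

/-- The splitting is asymmetric on purpose: `p' - p` meets only the unperturbed `f`, so no bound on
the perturbed solution is needed. -/
lemma norm_mulCLM_sub_mulCLM_le (p p' : Linf) (f f' : L2) :
    ‖mulCLM p' f' - mulCLM p f‖ ≤ ‖p'‖ * ‖f' - f‖ + ‖p' - p‖ * ‖f‖ := by
  rw [mulCLM_sub_sub_mulCLM]
  exact (norm_add_le _ _).trans (add_le_add (Lp.norm_smul_le _ _) (Lp.norm_smul_le _ _))

/-- Stability of solutions in `L²(0,1)` under perturbation of the coefficients in `L^∞` and of the
data in `L²`. The constant depends on the unperturbed solution and on a bound for the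
coefficients. -/
theorem IsSolution.exists_stability {T : ℝ} (hT : 0 ≤ T) {q a b : Linf} {u₀ u₁ : L2}
    {u : ℝ → L2} (hu : IsSolution T q a b u₀ u₁ u) {M : ℝ} (hM : 0 ≤ M) :
    ∃ R : ℝ, ∀ {q' a' b' : Linf} {u₀' u₁' : L2} {u' : ℝ → L2},
      IsSolution T q' a' b' u₀' u₁' u' → ‖q'‖ + ‖a'‖ ≤ M → ‖b'‖ ≤ M →
      ∀ t ∈ Icc 0 T, ‖u' t - u t‖ ^ 2 ≤ (‖u₀' - u₀‖ ^ 2 +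
        (‖u₁' - u₁‖ + (‖q' - q‖ + ‖a' - a‖ + ‖b' - b‖) * R + M * ‖u₀' - u₀‖) ^ 2) *
          Real.exp ((3 * M + 2) * T) := by
  obtain ⟨U, hU0, hU⟩ := exists_primitive hT hu.continuousOn
  have hUc : ContinuousOn U (Icc 0 T) := fun t ht => (hU t ht).continuousWithinAt
  obtain ⟨v, hv, hvc, hu0, hdg⟩ := hu.exists_diagonalGraph hU0 hU
  obtain ⟨R₁, hR₁⟩ := isCompact_Icc.exists_bound_of_continuousOn hUc
  obtain ⟨R₂, hR₂⟩ := isCompact_Icc.exists_bound_of_continuousOn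
    (hu.continuousOn.sub (continuousOn_const (c := u₀)))
  -- The constant bounds `U` and `u - u₀` on `[0,T]`, the two factors that coefficient differences
  -- multiply.
  refine ⟨max R₁ R₂, fun {q' a' b' u₀' u₁' u'} hu' hqa hb t ht => ?_⟩
  obtain ⟨U', hU0', hU'⟩ := exists_primitive hT hu'.continuousOn
  have hUc' : ContinuousOn U' (Icc 0 T) := fun t ht => (hU' t ht).continuousWithinAt
  obtain ⟨v', hv', hvc', hu0', hdg'⟩ := hu'.exists_diagonalGraph hU0' hU'
  -- Here `D = U' - U`, so that `d = u' - u` and `e = v' - v`; `g` gathers the terms that do not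
  -- involve `D` or `d`.
  have key := DiagonalGraph.energy_estimate (B := sineBasis) (T := T)
    (g := ‖u₁' - u₁‖ + (‖q' - q‖ + ‖a' - a‖ + ‖b' - b‖) * max R₁ R₂ + M * ‖u₀' - u₀‖)
    sineEigenvalue_nonneg hM
    (fun t ht => (hU' t ht).sub (hU t ht)) (fun t ht => (hv' t ht).sub (hv t ht)) ?_
    (fun t ht => (hdg' t ht).sub (hdg t ht)) (by simp [hU0, hU0']) ?_ t ht
  · simpa only [Pi.sub_apply, hu0, hu0'] using key
  · have := hu.continuousOn
    have := hu'.continuousOn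
    fun_prop
  · intro s hs
    -- The time derivatives `v'` and `v` cancel, leaving only bounded operators applied to
    -- primitives and solutions.
    have e : v' s - v s + (-(v' s - u₁' + (mulCLM q' (U' s) + mulCLM a' (U' s))
          + mulCLM b' (u' s - u₀')) - -(v s - u₁ + (mulCLM q (U s) + mulCLM a (U s))
          + mulCLM b (u s - u₀))) =
        (u₁' - u₁) - (mulCLM q' (U' s) - mulCLM q (U s)) - (mulCLM a' (U' s) - mulCLM a (U s))
          - (mulCLM b' (u' s - u₀') - mulCLM b (u s - u₀)) := by abel
    have hUs : ‖U s‖ ≤ max R₁ R₂ := (hR₁ s hs).trans (le_max_left _ _)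
    have hus : ‖u s - u₀‖ ≤ max R₁ R₂ := (hR₂ s hs).trans (le_max_right _ _)
    have hd : ‖(u' s - u₀') - (u s - u₀)‖ ≤ ‖u' s - u s‖ + ‖u₀' - u₀‖ := by
      rw [sub_sub_sub_comm]; exact norm_sub_le _ _
    calc _ ≤ ‖u₁' - u₁‖ + ‖mulCLM q' (U' s) - mulCLM q (U s)‖
          + ‖mulCLM a' (U' s) - mulCLM a (U s)‖
          + ‖mulCLM b' (u' s - u₀') - mulCLM b (u s - u₀)‖ := by
          rw [e]
          refine (norm_sub_le _ _).trans ?_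
          gcongr
          refine (norm_sub_le _ _).trans ?_
          gcongr
          exact norm_sub_le _ _
      _ ≤ ‖u₁' - u₁‖ + (‖q'‖ * ‖U' s - U s‖ + ‖q' - q‖ * max R₁ R₂)
          + (‖a'‖ * ‖U' s - U s‖ + ‖a' - a‖ * max R₁ R₂)
          + (M * (‖u' s - u s‖ + ‖u₀' - u₀‖) + ‖b' - b‖ * max R₁ R₂) := by
          gcongr
          · exact (norm_mulCLM_sub_mulCLM_le _ _ _ _).trans (by gcongr)
          · exact (norm_mulCLM_sub_mulCLM_le _ _ _ _).trans (by gcongr)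
          · exact (norm_mulCLM_sub_mulCLM_le _ _ _ _).trans (by gcongr)
      _ ≤ _ := by
          rw [show (U' - U) s = U' s - U s from rfl]
          nlinarith [mul_le_mul_of_nonneg_right hqa (norm_nonneg (U' s - U s))]

end SturmLiouvilleWave

/-! ### Passage to the limit -/

theorem mainTheorem10 (T : ℝ) (hT : 0 < T)
    (q a b : SturmLiouvilleWave.Linf) (ha : 0 ≤ a) (hb : 0 ≤ b)
    (u₀ u₁ : SturmLiouvilleWave.L2)
    (hu₀ : ∃ g, SturmLiouvilleWave.IsWeakSecondDeriv u₀ g)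
    (u : ℝ → SturmLiouvilleWave.L2)
    (hu : SturmLiouvilleWave.IsSolution T q a b u₀ u₁ u)
    (qε aε bε : ℝ → SturmLiouvilleWave.Linf)
    (u₀ε u₁ε : ℝ → SturmLiouvilleWave.L2)
    (haε : Tendsto (fun ε => ‖aε ε - a‖) (𝓝[>] 0) (𝓝 0))
    (hbε : Tendsto (fun ε => ‖bε ε - b‖) (𝓝[>] 0) (𝓝 0))
    (hqε : Tendsto (fun ε => ‖qε ε - q‖) (𝓝[>] 0) (𝓝 0))
    (hu₀ε : Tendsto (fun ε => ‖u₀ε ε - u₀‖) (𝓝[>] 0) (𝓝 0))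
    (hu₁ε : Tendsto (fun ε => ‖u₁ε ε - u₁‖) (𝓝[>] 0) (𝓝 0))
    (uε : ℝ → ℝ → SturmLiouvilleWave.L2)
    (huε : SturmLiouvilleWave.IsVeryWeakSolution T qε aε bε u₀ε u₁ε uε) :
    TendstoUniformlyOn uε u (𝓝[>] 0) (Icc 0 T) := by

  -- For small `ε` each coefficient is within `1` of its limit; the `2` covers `q` and `a`, whose
  -- norms enter the stability bound as a sum.
  set M := ‖q‖ + ‖a‖ + ‖b‖ + 2 with hM
  have hM0 : 0 ≤ M := by positivity
  obtain ⟨R, hR⟩ := hu.exists_stability hT.le hM0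
  rw [Metric.tendstoUniformlyOn_iff]
  intro η hη
  have hlim : Tendsto (fun ε => (‖u₀ε ε - u₀‖ ^ 2 + (‖u₁ε ε - u₁‖ +
      (‖qε ε - q‖ + ‖aε ε - a‖ + ‖bε ε - b‖) * R + M * ‖u₀ε ε - u₀‖) ^ 2) *
        Real.exp ((3 * M + 2) * T)) (𝓝[>] 0) (𝓝 0) := by
    have := ((hu₀ε.pow 2).add (((hu₁ε.add (((hqε.add haε).add hbε).mul_const R)).add
      (hu₀ε.const_mul M)).pow 2)).mul_const (Real.exp ((3 * M + 2) * T))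
    simpa using this
  filter_upwards [hlim.eventually_lt_const (show (0 : ℝ) < η ^ 2 by positivity),
    haε.eventually_lt_const one_pos, hbε.eventually_lt_const one_pos,
    hqε.eventually_lt_const one_pos, Ioc_mem_nhdsGT (zero_lt_one' ℝ)] with ε hε hεa hεb hεq hε1 t ht
  have hq' := norm_le_norm_add_norm_sub' (qε ε) q
  have ha' := norm_le_norm_add_norm_sub' (aε ε) a
  have hb' := norm_le_norm_add_norm_sub' (bε ε) b
  rw [dist_comm, dist_eq_norm]
  refine lt_of_pow_lt_pow_left₀ 2 hη.le ((hR (huε.solves ε hε1) ?_ ?_ t ht).trans_lt hε)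
  · linarith [norm_nonneg b]
  · linarith [norm_nonneg q, norm_nonneg a]
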